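/- Let $n\in\mathbb N$, $\hbar>0$ and $\mathcal H=L^2(\mathbb R^n)$, with inner product $\langle\psi|\phi\rangle=\int\psi^*\phi\,d^nx$. A bounded operator $\widehat A$ on $\mathcal H$ is a Weyl operator with symbol $a$, written $\widehat A=\operatorname{Op}_{\mathrm W}(a)$, where $a:\mathbb R^n_x\times\mathbb R^n_p\to\mathbb C$ is a measurable function, if $$\widehat A\phi(x)=\Big(\tfrac1{2\pi\hbar}\Big)^n\iint e^{\frac i\hbar p\cdot(x-y)}\,a\big(\tfrac12(x+y),p\big)\,\phi(y)\,d^ny\,d^np$$ in the weak sense: for all Schwartz functions $\phi,\psi$ on $\mathbb R^n$ the function $a\,W(\phi,\psi)$ is integrable and $\langle\psi|\widehat A\phi\rangle=\int a(z)\,W(\phi,\psi)(z)\,d^{2n}z$, where $W(\phi,\psi)(x,p)=(2\pi\hbar)^{-n}\int e^{-\frac i\hbar p\cdot y}\phi(x+\tfrac12y)\,\psi^*(x-\tfrac12y)\,d^ny$. A bounded operator $\widehat A$ is Hilbert–Schmidt if $\sum_j\|\widehat A\psi_j\|^2<\infty$ for some orthonormal basis $(\psi_j)$ of $\mathcal H$;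 it is of trace class if $\sum_j|\langle\widehat A\phi_j|\chi_j\rangle|<\infty$ for all pairs of orthonormal bases $(\phi_j)$, $(\chi_j)$ indexed by the same set, and then $\operatorname{Tr}(\widehat A)=\sum_j\langle\psi_j|\widehat A\psi_j\rangle$ for any orthonormal basis $(\psi_j)$. **Theorem.** Let $\widehat A=\operatorname{Op}_{\mathrm W}(a)$ and $\widehat B=\operatorname{Op}_{\mathrm W}(b)$ be Hilbert–Schmidt operators on $L^2(\mathbb R^n)$. Then $a,b\in L^2(\mathbb R^{2n})$, all integrals below converge absolutely, and the following hold, with all sums over orthonormal bases independent of the basis. (i) $\widehat A\widehat B$ is of trace class and $$\operatorname{Tr}(\widehat A\widehat B)=\Big(\tfrac1{2\pi\hbar}\Big)^n\int a(z)\,b(z)\,d^{2n}z .$$ (ii) $\widehat A^\dagger\widehat B$ is of trace class, and the Hilbert–Schmidt inner product $\langle\widehat A|\widehat B\rangle_{\mathrm{HS}}=\operatorname{Tr}(\widehat A^\dagger\widehat B)=\sum_j\langle\widehat A\psi_j|\widehat B\psi_j\rangle$ is $$\langle\widehat A|\widehat B\rangle_{\mathrm{HS}}=\Big(\tfrac1{2\pi\hbar}\Big)^n\int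 a^*(z)\,b(z)\,d^{2n}z .$$ Hence the Hilbert–Schmidt norm $\|\widehat A\|_{\mathrm{HS}}=\big(\sum_j\|\widehat A\psi_j\|^2\big)^{1/2}$ satisfies $$\|\widehat A\|_{\mathrm{HS}}^2=\operatorname{Tr}(\widehat A^\dagger\widehat A)=\Big(\tfrac1{2\pi\hbar}\Big)^n\int|a(z)|^2\,d^{2n}z .$$ -/

import Mathlib

open MeasureTheory
open scoped ComplexConjugate SchwartzMap

namespace WeylTrace

section HilbertSpace

universe u

variable {H : Type u} [NormedAddCommGroup H] [InnerProductSpace ℂ H] [CompleteSpace H]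

/-- A bounded operator `T` is Hilbert–Schmidt if `∑ j, ‖T ψ_j‖² < ∞` for some orthonormal
basis `(ψ_j)`. -/
def IsHilbertSchmidt (T : H →L[ℂ] H) : Prop :=
  ∃ (ι : Type u) (ψ : HilbertBasis ι ℂ H), Summable fun j => ‖T (ψ j)‖ ^ 2

/-- A bounded operator `T` is of trace class if `∑ j, |⟨T φ_j | χ_j⟩| < ∞` for all pairs of
orthonormal bases `(φ_j)`, `(χ_j)` indexed by the same set. (Requiring this for a single pair
only would be too weak: the identity would qualify, with `χ` a fixed-point-free rearrangement
of `φ`.) -/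
def IsTraceClass (T : H →L[ℂ] H) : Prop :=
  ∀ (ι : Type u) (φ χ : HilbertBasis ι ℂ H), Summable fun j => ‖inner ℂ (T (φ j)) (χ j)‖

/-- `HasTrace T t` says `Tr T = t`: for every orthonormal basis `(ψ_j)` the series
`∑ j, ⟨ψ_j | T ψ_j⟩` converges (unconditionally, hence absolutely) with sum `t`. -/
def HasTrace (T : H →L[ℂ] H) (t : ℂ) : Prop :=
  ∀ (ι : Type u) (ψ : HilbertBasis ι ℂ H), HasSum (fun j => inner ℂ (ψ j) (T (ψ j))) t

/-- The trace is unique. -/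
theorem HasTrace.unique {T : H →L[ℂ] H} {s t : ℂ} (hs : HasTrace T s) (ht : HasTrace T t) :
    s = t := by
  obtain ⟨w, ψ, -⟩ := exists_hilbertBasis ℂ H
  exact (hs w ψ).unique (ht w ψ)

/-- `HasHSInner A B c` says `⟨A | B⟩_HS = c`: one has `Tr (A† B) = c`, and
`∑ j, ⟨A ψ_j | B ψ_j⟩ = c` for every orthonormal basis `(ψ_j)`. -/
def HasHSInner (A B : H →L[ℂ] H) (c : ℂ) : Prop :=
  HasTrace (ContinuousLinearMap.adjoint A ∘L B) c ∧
    ∀ (ι : Type u) (ψ : HilbertBasis ι ℂ H), HasSum (fun j => inner ℂ (A (ψ j)) (B (ψ j))) c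

/-- `HasHSNorm A r` says `‖A‖_HS = r`: one has `r ≥ 0` and `∑ j, ‖A ψ_j‖² = r²` for every
orthonormal basis `(ψ_j)`. -/
def HasHSNorm (A : H →L[ℂ] H) (r : ℝ) : Prop :=
  0 ≤ r ∧ ∀ (ι : Type u) (ψ : HilbertBasis ι ℂ H), HasSum (fun j => ‖A (ψ j)‖ ^ 2) (r ^ 2)

end HilbertSpace

/-- Configuration (or momentum) space `ℝⁿ` with its Euclidean structure. Phase space `ℝ²ⁿ` is
`Conf n × Conf n`, with points `z = (x, p)` and Lebesgue measure `dz = dx dp`. -/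
abbrev Conf (n : ℕ) : Type := EuclideanSpace ℝ (Fin n)

/-- The Hilbert space `L²(ℝⁿ)`. -/
abbrev StateSpace (n : ℕ) : Type := Lp ℂ 2 (volume : Measure (Conf n))

/-- The cross-Wigner transform
`W(φ, ψ)(x, p) = (2πħ)⁻ⁿ ∫ e^{-(i/ħ) p·y} φ(x + y/2) ψ*(x - y/2) dy`. -/
noncomputable def crossWigner {n : ℕ} (ħ : ℝ) (φ ψ : Conf n → ℂ) (z : Conf n × Conf n) : ℂ :=
  ((1 / (2 * Real.pi * ħ)) ^ n : ℝ) *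
    ∫ y : Conf n, Complex.exp (-(Complex.I / (ħ : ℂ)) * (inner ℝ z.2 y : ℝ)) *
      φ (z.1 + (1 / 2 : ℝ) • y) * conj (ψ (z.1 - (1 / 2 : ℝ) • y))

/-- `IsWeylOperator ħ a A` says `A = Op_W(a)`, where
`A φ(x) = (2πħ)⁻ⁿ ∬ e^{(i/ħ) p·(x-y)} a((x+y)/2, p) φ(y) dy dp`
is understood in the weak sense, so that it is meaningful for symbols `a` that are not
absolutely integrable: pairing with `ψ*` and passing to the midpoint and difference variables,
`⟨ψ | A φ⟩ = ∫ a(z) W(φ, ψ)(z) dz` for all Schwartz functions `φ`, `ψ`. -/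
def IsWeylOperator {n : ℕ} (ħ : ℝ) (a : Conf n × Conf n → ℂ)
    (A : StateSpace n →L[ℂ] StateSpace n) : Prop :=
  AEStronglyMeasurable a volume ∧
    ∀ φ ψ : 𝓢(Conf n, ℂ),
      Integrable (fun z => a z * crossWigner ħ φ ψ z) volume ∧
        inner ℂ (ψ.toLp 2 volume) (A (φ.toLp 2 volume)) = ∫ z, a z * crossWigner ħ φ ψ z

end WeylTrace

/-! The engine is Moyal's identity: the cross-Wigner transform satisfies ⟨W(φ₁, ψ₁)|W(φ₂, ψ₂)⟩ =
(2πħ)⁻ⁿ ⟨φ₁|φ₂⟩⟨ψ₂|ψ₁⟩. It is Plancherel in p followed by the unimodular substitution (x, y) ↦ (x +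
y/2, x - y/2). So, for an orthonormal basis (e_j) of Schwartz functions, the functions W(e_k, e_j)
are orthonormal in L²(ℝ²ⁿ) up to the factor (2πħ)^{-n/2}.

A Hilbert–Schmidt operator has a square summable matrix ⟨e_k|A e_j⟩. The series (2πħ)ⁿ ∑ ⟨e_k|A e_j⟩
W(e_k, e_j) therefore converges in L² to a function `hsSymbol`, which is a Weyl symbol of A in the
weak sense, and the map from matrices to symbols is isometric up to scale. Completeness of the
W(e_k, e_j) is not needed.

The given symbol a is only known to be integrable against cross-Wigner transforms, so it must still
be identified with `hsSymbol`. This is the uniqueness result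
`ae_eq_zero_of_integral_mul_crossWigner`: phase-space translates of one test function turn the
hypothesis into the vanishing of a Fourier transform. Both a ∈ L² and the formula for ⟨A|B⟩_HS
follow. The formula for Tr(AB) is the same one applied to A†, whose symbol is a*. -/

namespace WeylTrace

/-! ### Hilbert–Schmidt operators: independence of the basis -/

section HilbertSchmidt

universe u

variable {H : Type u} [NormedAddCommGroup H] [InnerProductSpace ℂ H]
variable {ι κ : Type*}

theorem hasSum_norm_inner_sq (b : HilbertBasis ι ℂ H) (x : H) :
    HasSum (fun i => ‖inner ℂ (b i) x‖ ^ 2) (‖x‖ ^ 2) := by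
  have h := b.hasSum_inner_mul_inner x x
  rw [inner_self_eq_norm_sq_to_K] at h
  have h2 := Complex.hasSum_re h
  convert h2 using 1
  · ext i
    rw [← inner_conj_symm x (b i), ← Complex.normSq_eq_conj_mul_self, Complex.normSq_eq_norm_sq,
      Complex.ofReal_re]
  · norm_cast

/-- The matrix of a Hilbert–Schmidt operator is square summable. -/
theorem summable_norm_inner_sq {A : H →L[ℂ] H} (e : HilbertBasis ι ℂ H) (f : HilbertBasis κ ℂ H)
    (h : Summable fun i => ‖A (e i)‖ ^ 2) :
    Summable fun p : ι × κ => ‖inner ℂ (f p.2) (A (e p.1))‖ ^ 2 := by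
  rw [summable_prod_of_nonneg (fun _ => by positivity)]
  refine ⟨fun i => (hasSum_norm_inner_sq f (A (e i))).summable, ?_⟩
  simpa only [(hasSum_norm_inner_sq f (A (e _))).tsum_eq] using h

variable [CompleteSpace H]

/-- The matrices of A and A† are conjugate transposes, so one double series of squares is summed by
rows or by columns. The bases e and f are unrelated, so two applications change the basis. -/
theorem summable_norm_adjoint_sq {A : H →L[ℂ] H} (e : HilbertBasis ι ℂ H) (f : HilbertBasis κ ℂ H)
    (h : Summable fun i => ‖A (e i)‖ ^ 2) :
    Summable fun k => ‖ContinuousLinearMap.adjoint A (f k)‖ ^ 2 := by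
  have h1 := (summable_norm_inner_sq e f h).prod_symm
  rw [summable_prod_of_nonneg (fun _ => by positivity)] at h1
  refine h1.2.congr fun k => ?_
  rw [← (hasSum_norm_inner_sq e (ContinuousLinearMap.adjoint A (f k))).tsum_eq]
  refine tsum_congr fun i => ?_
  rw [ContinuousLinearMap.adjoint_inner_right, norm_inner_symm]
  rfl

/-- The Hilbert–Schmidt condition does not depend on the orthonormal basis. -/
theorem IsHilbertSchmidt.summable {A : H →L[ℂ] H} (hA : IsHilbertSchmidt A)
    (f : HilbertBasis κ ℂ H) : Summable fun k => ‖A (f k)‖ ^ 2 := by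
  obtain ⟨ι, e, h⟩ := hA
  simpa using summable_norm_adjoint_sq f f (summable_norm_adjoint_sq e f h)

theorem IsHilbertSchmidt.adjoint {A : H →L[ℂ] H} (hA : IsHilbertSchmidt A) :
    IsHilbertSchmidt (ContinuousLinearMap.adjoint A) := by
  obtain ⟨ι, e, h⟩ := hA
  exact ⟨ι, e, summable_norm_adjoint_sq e e h⟩

theorem IsHilbertSchmidt.isTraceClass_adjoint_comp {A B : H →L[ℂ] H} (hA : IsHilbertSchmidt A)
    (hB : IsHilbertSchmidt B) : IsTraceClass (ContinuousLinearMap.adjoint A ∘L B) := by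
  intro ι φ χ
  refine Summable.of_nonneg_of_le (fun _ => norm_nonneg _) (fun j => ?_)
    ((hB.summable φ).add (hA.summable χ))
  rw [ContinuousLinearMap.comp_apply, ContinuousLinearMap.adjoint_inner_left]
  refine (norm_inner_le_norm _ _).trans ?_
  nlinarith [sq_nonneg (‖B (φ j)‖ - ‖A (χ j)‖), sq_nonneg ‖B (φ j)‖, sq_nonneg ‖A (χ j)‖]

/-- Parseval's identity for the matrices of two Hilbert–Schmidt operators. -/
theorem IsHilbertSchmidt.hasSum_matrix {A B : H →L[ℂ] H} (hA : IsHilbertSchmidt A)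
    (hB : IsHilbertSchmidt B) (e : HilbertBasis ι ℂ H) (f : HilbertBasis κ ℂ H) {s : ℂ}
    (hs : HasSum (fun i => inner ℂ (A (e i)) (B (e i))) s) :
    HasSum (fun p : ι × κ =>
      inner ℂ (A (e p.1)) (f p.2) * inner ℂ (f p.2) (B (e p.1))) s := by
  have hsum : Summable fun p : ι × κ =>
      inner ℂ (A (e p.1)) (f p.2) * inner ℂ (f p.2) (B (e p.1)) := by
    refine Summable.of_norm_bounded ((summable_norm_inner_sq e f (hA.summable e)).add
      (summable_norm_inner_sq e f (hB.summable e))) fun p => ?_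
    rw [norm_mul, norm_inner_symm]
    nlinarith [sq_nonneg (‖inner ℂ (f p.2) (A (e p.1))‖ - ‖inner ℂ (f p.2) (B (e p.1))‖),
      sq_nonneg ‖inner ℂ (f p.2) (A (e p.1))‖, sq_nonneg ‖inner ℂ (f p.2) (B (e p.1))‖]
  have h := hsum.hasSum.prod_fiberwise fun i => f.hasSum_inner_mul_inner (A (e i)) (B (e i))
  rw [hs.unique h]
  exact hsum.hasSum

/-- Both sums are iterated sums of the absolutely convergent double series in `hasSum_matrix`, taken
in the two orders. -/
theorem IsHilbertSchmidt.hasSum_inner_adjoint {A B : H →L[ℂ] H} (hA : IsHilbertSchmidt A)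
    (hB : IsHilbertSchmidt B) (e : HilbertBasis ι ℂ H) (f : HilbertBasis κ ℂ H) {s : ℂ}
    (hs : HasSum (fun i => inner ℂ (A (e i)) (B (e i))) s) :
    HasSum (fun k => inner ℂ (ContinuousLinearMap.adjoint B (f k))
      (ContinuousLinearMap.adjoint A (f k))) s := by
  have h := (Equiv.prodComm κ ι).hasSum_iff.2 (hA.hasSum_matrix hB e f hs)
  refine h.prod_fiberwise fun k => ?_
  refine (e.hasSum_inner_mul_inner (ContinuousLinearMap.adjoint B (f k))
    (ContinuousLinearMap.adjoint A (f k))).congr_fun fun i => ?_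
  simp only [Function.comp_apply, Equiv.prodComm_apply, Prod.swap_prod_mk,
    ContinuousLinearMap.adjoint_inner_left, ContinuousLinearMap.adjoint_inner_right]
  exact mul_comm _ _

/-- The sum defining the Hilbert–Schmidt inner product does not depend on the basis. -/
theorem IsHilbertSchmidt.hasHSInner {A B : H →L[ℂ] H} (hA : IsHilbertSchmidt A)
    (hB : IsHilbertSchmidt B) (e : HilbertBasis ι ℂ H) {s : ℂ}
    (hs : HasSum (fun i => inner ℂ (A (e i)) (B (e i))) s) : HasHSInner A B s := by
  have h (κ : Type u) (f : HilbertBasis κ ℂ H) :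
      HasSum (fun k => inner ℂ (A (f k)) (B (f k))) s := by
    -- Passing to adjoints moves the sum from e to f; passing back with f on both sides restores A
    -- and B.
    simpa using hB.adjoint.hasSum_inner_adjoint hA.adjoint f f (hA.hasSum_inner_adjoint hB e f hs)
  refine ⟨fun κ f => ?_, h⟩
  simpa [ContinuousLinearMap.adjoint_inner_right] using h κ f

/-- A dense subspace of a separable Hilbert space contains an orthonormal basis. -/
theorem exists_hilbertBasis_mem [TopologicalSpace.SeparableSpace H] (S : Submodule ℂ H)
    (hS : Dense (S : Set H)) :
    ∃ (ι : Type) (e : HilbertBasis ι ℂ H), ∀ i, e i ∈ S := by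
  obtain ⟨t, htS, htc, ht⟩ := (TopologicalSpace.IsSeparable.of_separableSpace
    (S : Set H)).exists_countable_dense_subset
  have hne : t.Nonempty := by
    rcases t.eq_empty_or_nonempty with rfl | h
    · simpa using ht S.zero_mem
    · exact h
  obtain ⟨u, rfl⟩ := htc.exists_eq_range hne
  have hspan := InnerProductSpace.span_gramSchmidtNormed_range (𝕜 := ℂ) u
  rw [InnerProductSpace.span_gramSchmidt] at hspan
  have ho := InnerProductSpace.gramSchmidtNormed_orthonormal' (𝕜 := ℂ) u
  -- Gram–Schmidt yields zero at linearly dependent vectors; discarding these does not change the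
  -- span.
  have hr : Submodule.span ℂ (Set.range fun i : {i | InnerProductSpace.gramSchmidtNormed ℂ u i ≠ 0} =>
      InnerProductSpace.gramSchmidtNormed ℂ u i) = Submodule.span ℂ (Set.range u) := by
    rw [← hspan]
    refine le_antisymm (Submodule.span_mono ?_) (Submodule.span_le.2 ?_)
    · rintro _ ⟨i, rfl⟩
      exact ⟨i, rfl⟩
    · rintro _ ⟨i, rfl⟩
      by_cases hi : InnerProductSpace.gramSchmidtNormed ℂ u i = 0
      · rw [hi]; exact Submodule.zero_mem _
      · exact Submodule.subset_span ⟨⟨i, hi⟩, rfl⟩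
  refine ⟨_, HilbertBasis.mk ho ?_, fun i => ?_⟩
  · rw [hr]
    intro x _
    have hx : x ∈ closure (S : Set H) := hS x
    rw [← SetLike.mem_coe, Submodule.topologicalClosure_coe]
    exact closure_minimal (ht.trans (closure_mono Submodule.subset_span)) isClosed_closure hx
  · rw [HilbertBasis.coe_mk]
    have : InnerProductSpace.gramSchmidtNormed ℂ u i ∈ Submodule.span ℂ (Set.range u) := by
      rw [← hspan]; exact Submodule.subset_span ⟨i, rfl⟩
    exact Submodule.span_le.2 htS this

end HilbertSchmidt

/-! ### Moyal's identity for cross-Wigner transforms -/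

section Moyal

open scoped FourierTransform

variable {n : ℕ} {ħ : ℝ}

/-- The function `y ↦ φ(x + y/2) ψ*(x - y/2)` whose Fourier transform is the cross-Wigner
transform at position `x`. -/
noncomputable def wignerSlice (φ ψ : 𝓢(Conf n, ℂ)) (x : Conf n) : 𝓢(Conf n, ℂ) :=
  SchwartzMap.smulLeftCLM ℂ
    (SchwartzMap.compCLMOfContinuousLinearEquiv ℝ
      (ContinuousLinearEquiv.smulLeft (Units.mk0 (1 / 2 : ℝ) (by norm_num)))
      (SchwartzMap.compSubConstCLM ℝ (-x) φ))
    (SchwartzMap.compCLMOfContinuousLinearEquiv ℝ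
      (ContinuousLinearEquiv.smulLeft (Units.mk0 (-(1 / 2) : ℝ) (by norm_num)))
      (SchwartzMap.compSubConstCLM ℝ (-x)
        (SchwartzMap.postcompCLM (Complex.conjCLE : ℂ →L[ℝ] ℂ) ψ)))

theorem wignerSlice_apply (φ ψ : 𝓢(Conf n, ℂ)) (x y : Conf n) :
    wignerSlice φ ψ x y = φ (x + (1 / 2 : ℝ) • y) * conj (ψ (x - (1 / 2 : ℝ) • y)) := by
  rw [wignerSlice, SchwartzMap.smulLeftCLM_apply_apply (SchwartzMap.hasTemperateGrowth _)]
  simp [ContinuousLinearEquiv.smulLeft, Units.smul_def, sub_eq_add_neg, add_comm]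

theorem crossWigner_eq_fourier (φ ψ : 𝓢(Conf n, ℂ)) (x p : Conf n) :
    crossWigner ħ φ ψ (x, p) = ((1 / (2 * Real.pi * ħ)) ^ n : ℝ) *
      𝓕 (wignerSlice φ ψ x) ((1 / (2 * Real.pi * ħ)) • p) := by
  rw [crossWigner, SchwartzMap.fourier_coe, Real.fourier_eq']
  congr 2
  funext y
  rw [wignerSlice_apply, smul_eq_mul, mul_assoc]
  congr 2
  by_cases h : ħ = 0
  · simp [h]
  · rw [inner_smul_right, real_inner_comm]
    have : (ħ : ℂ) ≠ 0 := by exact_mod_cast h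
    have hpi : (Real.pi : ℂ) ≠ 0 := by exact_mod_cast Real.pi_ne_zero
    push_cast
    field_simp

theorem stronglyMeasurable_crossWigner (φ ψ : 𝓢(Conf n, ℂ)) :
    StronglyMeasurable (crossWigner ħ φ ψ) := by
  have h : Continuous fun q : (Conf n × Conf n) × Conf n =>
      Complex.exp (-(Complex.I / (ħ : ℂ)) * (inner ℝ q.1.2 q.2 : ℝ)) *
      φ (q.1.1 + (1 / 2 : ℝ) • q.2) * conj (ψ (q.1.1 - (1 / 2 : ℝ) • q.2)) := by
    have := φ.continuous
    have := ψ.continuous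
    fun_prop
  exact (h.stronglyMeasurable.integral_prod_right).const_mul _

theorem integral_comp_scaled (hħ : 0 < ħ) {E : Type*} [NormedAddCommGroup E] [NormedSpace ℝ E]
    (f : Conf n → E) :
    ∫ p, f ((1 / (2 * Real.pi * ħ)) • p) = ((2 * Real.pi * ħ) ^ n : ℝ) • ∫ p, f p := by
  have hpi := Real.pi_pos
  rw [Measure.integral_comp_smul, finrank_euclideanSpace_fin, one_div, inv_pow, inv_inv, abs_of_pos]
  positivity

theorem integrable_comp_scaled (hħ : 0 < ħ) {E : Type*} [NormedAddCommGroup E] [NormedSpace ℝ E]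
    {f : Conf n → E} (hf : Integrable f) :
    Integrable fun p => f ((1 / (2 * Real.pi * ħ)) • p) := by
  have hpi := Real.pi_pos
  exact hf.comp_smul (by positivity)

/-- The passage to midpoint and difference variables preserves Lebesgue measure. -/
theorem measurePreserving_midpoint_difference :
    MeasurePreserving (fun q : Conf n × Conf n =>
      (q.1 + (1 / 2 : ℝ) • q.2, q.1 - (1 / 2 : ℝ) • q.2)) := by
  have h1 : MeasurePreserving (fun q : Conf n × Conf n => (q.1, q.2 + (1 / 2 : ℝ) • q.1))
      (volume.prod volume) (volume.prod volume) :=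
    (MeasurePreserving.id _).skew_product (g := fun y x => x + (1 / 2 : ℝ) • y) (by fun_prop)
      (Filter.Eventually.of_forall fun y => map_add_right_eq_self _ _)
  have h2 : MeasurePreserving (fun q : Conf n × Conf n => (q.1, q.1 - q.2))
      (volume.prod volume) (volume.prod volume) :=
    (MeasurePreserving.id _).skew_product (g := fun u y => u - y) (by fun_prop)
      (Filter.Eventually.of_forall fun u => (Measure.measurePreserving_sub_left volume u).map_eq)
  have hs : MeasurePreserving (Prod.swap : Conf n × Conf n → _)
      (volume.prod volume) (volume.prod volume) := Measure.measurePreserving_swap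
  -- The map is a composite of (x, y) ↦ (x + y/2, y) and (u, y) ↦ (u, u - y), each preserving
  -- measure fibrewise.
  have h := h2.comp (hs.comp (h1.comp hs))
  rw [Measure.volume_eq_prod]
  convert h using 1
  funext q
  ext1
  · rfl
  · change q.1 - (1 / 2 : ℝ) • q.2 = (q.1 + (1 / 2 : ℝ) • q.2) - q.2
    module

/-- In the variables u = x + y/2, v = x - y/2 the integrand is a function of u times a function of
v, so the integral factors. -/
theorem integrable_wignerSlice_inner (φ₁ ψ₁ φ₂ ψ₂ : 𝓢(Conf n, ℂ)) :
    Integrable (fun q : Conf n × Conf n =>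
      conj (wignerSlice φ₁ ψ₁ q.1 q.2) * wignerSlice φ₂ ψ₂ q.1 q.2) ∧
    ∫ q : Conf n × Conf n, conj (wignerSlice φ₁ ψ₁ q.1 q.2) * wignerSlice φ₂ ψ₂ q.1 q.2 =
      inner ℂ (φ₁.toLp 2) (φ₂.toLp 2) * inner ℂ (ψ₂.toLp 2) (ψ₁.toLp 2) := by
  have hint (f g : 𝓢(Conf n, ℂ)) : Integrable fun x => conj (f x) * g x := by
    have := (f.memLp 2).star.integrable_mul (g.memLp 2)
    exact this
  have h := (hint φ₁ φ₂).mul_prod (hint ψ₂ ψ₁)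
  have heq : (fun q : Conf n × Conf n =>
      conj (wignerSlice φ₁ ψ₁ q.1 q.2) * wignerSlice φ₂ ψ₂ q.1 q.2) =
      (fun r : Conf n × Conf n => (conj (φ₁ r.1) * φ₂ r.1) * (conj (ψ₂ r.2) * ψ₁ r.2)) ∘
        fun q => (q.1 + (1 / 2 : ℝ) • q.2, q.1 - (1 / 2 : ℝ) • q.2) := by
    funext q
    simp only [wignerSlice_apply, Function.comp_apply, map_mul, Complex.conj_conj]
    ring
  have hT := measurePreserving_midpoint_difference (n := n)
  refine ⟨?_, ?_⟩
  · rw [heq]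
    exact hT.integrable_comp_of_integrable h
  · rw [heq]
    rw [Function.comp_def, ← integral_map (f := fun r : Conf n × Conf n =>
      (conj (φ₁ r.1) * φ₂ r.1) * (conj (ψ₂ r.2) * ψ₁ r.2)) hT.aemeasurable
      (by rw [hT.map_eq]; exact h.aestronglyMeasurable), hT.map_eq]
    rw [Measure.volume_eq_prod, integral_prod_mul (fun u => conj (φ₁ u) * φ₂ u)
      (fun v => conj (ψ₂ v) * ψ₁ v), L2.inner_def, L2.inner_def]
    congr 1
    · refine integral_congr_ae ?_
      filter_upwards [φ₁.coeFn_toLp 2, φ₂.coeFn_toLp 2] with x h1 h2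
      rw [h1, h2, RCLike.inner_apply, mul_comm]
    · refine integral_congr_ae ?_
      filter_upwards [ψ₁.coeFn_toLp 2, ψ₂.coeFn_toLp 2] with x h1 h2
      rw [h1, h2, RCLike.inner_apply, mul_comm]

/-- Plancherel's identity in the momentum variable. -/
theorem integral_inner_crossWigner_right (hħ : 0 < ħ) (φ₁ ψ₁ φ₂ ψ₂ : 𝓢(Conf n, ℂ)) (x : Conf n) :
    ∫ p, conj (crossWigner ħ φ₁ ψ₁ (x, p)) * crossWigner ħ φ₂ ψ₂ (x, p) =
      ((1 / (2 * Real.pi * ħ)) ^ n : ℝ) *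
        ∫ y, conj (wignerSlice φ₁ ψ₁ x y) * wignerSlice φ₂ ψ₂ x y := by
  have hpi := Real.pi_pos
  have hP := SchwartzMap.integral_inner_fourier_fourier (wignerSlice φ₁ ψ₁ x) (wignerSlice φ₂ ψ₂ x)
  simp only [RCLike.inner_apply'] at hP
  rw [← hP]
  have h1 (p : Conf n) : conj (crossWigner ħ φ₁ ψ₁ (x, p)) * crossWigner ħ φ₂ ψ₂ (x, p) =
      (((1 / (2 * Real.pi * ħ)) ^ n : ℝ) ^ 2 : ℂ) *
      (fun q => conj (𝓕 (wignerSlice φ₁ ψ₁ x) q) * 𝓕 (wignerSlice φ₂ ψ₂ x) q)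
        ((1 / (2 * Real.pi * ħ)) • p) := by
    rw [crossWigner_eq_fourier, crossWigner_eq_fourier, map_mul, Complex.conj_ofReal]
    ring
  simp only [h1]
  -- The Jacobian (2πħ)ⁿ of the rescaling cancels one of the two prefactors (2πħ)⁻ⁿ.
  rw [integral_const_mul, integral_comp_scaled hħ (fun q =>
    conj (𝓕 (wignerSlice φ₁ ψ₁ x) q) * 𝓕 (wignerSlice φ₂ ψ₂ x) q), Complex.real_smul, ← mul_assoc]
  congr 1
  norm_cast
  rw [sq, mul_assoc, ← mul_pow, one_div_mul_cancel (by positivity), one_pow, mul_one]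

theorem memLp_crossWigner (hħ : 0 < ħ) (φ ψ : 𝓢(Conf n, ℂ)) :
    MemLp (crossWigner ħ φ ψ) 2 volume := by
  have hm := stronglyMeasurable_crossWigner (ħ := ħ) φ ψ
  rw [memLp_two_iff_integrable_sq_norm hm.aestronglyMeasurable, Measure.volume_eq_prod,
    integrable_prod_iff (f := fun z => ‖crossWigner ħ φ ψ z‖ ^ 2)
      (hm.norm.pow 2).aestronglyMeasurable]
  have hn (z : ℂ) : ((‖z‖ ^ 2 : ℝ) : ℂ) = conj z * z := by
    rw [← Complex.normSq_eq_conj_mul_self, Complex.normSq_eq_norm_sq]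
  refine ⟨Filter.Eventually.of_forall fun x => ?_, ?_⟩
  · have h := ((memLp_two_iff_integrable_sq_norm (SchwartzMap.continuous _).aestronglyMeasurable).1
      ((𝓕 (wignerSlice φ ψ x)).memLp 2))
    simp only [crossWigner_eq_fourier, norm_mul, mul_pow]
    exact (integrable_comp_scaled hħ h).const_mul _
  -- By Plancherel the integral over p is a multiple of the integral of |slice|² over y, which is
  -- integrable in x by Fubini.
  · have h := (integrable_wignerSlice_inner φ ψ φ ψ).1
    rw [Measure.volume_eq_prod] at h
    have h2 := (h.integral_prod_left.const_mul (((1 / (2 * Real.pi * ħ)) ^ n : ℝ) : ℂ)).re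
    refine h2.congr (Filter.Eventually.of_forall fun x => ?_)
    dsimp only
    rw [← integral_inner_crossWigner_right hħ]
    simp only [← hn]
    rw [integral_complex_ofReal]
    simp

/-- Moyal's identity. -/
theorem integral_inner_crossWigner (hħ : 0 < ħ) (φ₁ ψ₁ φ₂ ψ₂ : 𝓢(Conf n, ℂ)) :
    ∫ z, conj (crossWigner ħ φ₁ ψ₁ z) * crossWigner ħ φ₂ ψ₂ z =
      ((1 / (2 * Real.pi * ħ)) ^ n : ℝ) *
        (inner ℂ (φ₁.toLp 2) (φ₂.toLp 2) * inner ℂ (ψ₂.toLp 2) (ψ₁.toLp 2)) := by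
  have hi : Integrable (fun z => conj (crossWigner ħ φ₁ ψ₁ z) * crossWigner ħ φ₂ ψ₂ z) :=
    (memLp_crossWigner hħ φ₁ ψ₁).star.integrable_mul (memLp_crossWigner hħ φ₂ ψ₂)
  have hs := integrable_wignerSlice_inner φ₁ ψ₁ φ₂ ψ₂
  rw [← hs.2]
  have hs1 := hs.1
  rw [Measure.volume_eq_prod] at hi hs1 ⊢
  rw [integral_prod _ hi, integral_prod _ hs1, ← integral_const_mul]
  simp only [integral_inner_crossWigner_right hħ]

end Moyal

/-! ### Uniqueness for Fourier transforms of integrable functions -/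

section FourierUniqueness

variable {V W : Type*} [AddCommGroup V] [Module ℝ V] [PseudoEMetricSpace V] [MeasurableSpace V]
  [BorelSpace V] [AddCommGroup W] [Module ℝ W]
  [TopologicalSpace W] {L : V →ₗ[ℝ] W →ₗ[ℝ] ℝ} {μ : Measure V}

theorem integrable_mul_exp (hL : Continuous fun p : V × W => L p.1 p.2) {f : V → ℂ}
    (hf : Integrable f μ) (w : W) :
    Integrable (fun v => f v * Complex.exp (L v w * Complex.I)) μ := by
  have hc : Continuous fun v => L v w := hL.comp (by fun_prop : Continuous fun v : V => (v, w))
  refine hf.mul_bdd (c := 1) (by fun_prop) (Filter.Eventually.of_forall fun v => ?_)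
  rw [Complex.norm_exp_ofReal_mul_I]

variable [CompleteSpace V] [SecondCountableTopology V]

/-- The positive and negative parts of f are densities of two finite measures with the same
characteristic function; these coincide, so f⁺ = f⁻ almost everywhere. -/
theorem ae_eq_zero_of_integral_ofReal_mul_exp_eq_zero [SigmaFinite μ] (hL' : ∀ v ≠ 0, L v ≠ 0)
    (hL : Continuous fun p : V × W => L p.1 p.2) {f : V → ℝ} (hf : Integrable f μ)
    (h : ∀ w, ∫ v, (f v : ℂ) * Complex.exp (L v w * Complex.I) ∂μ = 0) : f =ᵐ[μ] 0 := by
  have hm := hf.aemeasurable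
  have hfin (g : V → ℝ) (hg : Integrable g μ) :
      IsFiniteMeasure (μ.withDensity fun v => ENNReal.ofReal (g v)) :=
    isFiniteMeasure_withDensity_ofReal hg.2
  have := hfin f hf
  have := hfin (-f) hf.neg
  have key : (μ.withDensity fun v => ENNReal.ofReal (f v)) =
      μ.withDensity fun v => ENNReal.ofReal ((-f) v) := by
    refine ext_of_integral_char_eq Real.continuous_probChar
      Real.probChar_ne_one hL' hL fun w => ?_
    rw [integral_withDensity_eq_integral_toReal_smul₀ hm.ennreal_ofReal (by simp),
      integral_withDensity_eq_integral_toReal_smul₀ hm.neg.ennreal_ofReal (by simp), ← sub_eq_zero,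
      ← integral_sub, ← h w]
    · refine integral_congr_ae (Filter.Eventually.of_forall fun v => ?_)
      change _ • Complex.exp (L v w * Complex.I) - _ • Complex.exp (L v w * Complex.I) = _
      rw [← sub_smul, Complex.real_smul]
      congr 2
      rcases le_total 0 (f v) with h0 | h0 <;>
        simp [h0, ENNReal.toReal_ofReal, ENNReal.ofReal_of_nonpos]
    · have := integrable_mul_exp (W := W) hL (hf.pos_part.ofReal (𝕜 := ℂ)) w
      simp only [ENNReal.toReal_ofReal', Complex.real_smul]
      exact this
    · have := integrable_mul_exp (W := W) hL (hf.neg_part.ofReal (𝕜 := ℂ)) w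
      simp only [ENNReal.toReal_ofReal', Complex.real_smul]
      exact this
  rw [withDensity_eq_iff_of_sigmaFinite hm.ennreal_ofReal hm.neg.ennreal_ofReal] at key
  filter_upwards [key] with v hv
  rcases le_total 0 (f v) with h0 | h0
  · have : ENNReal.ofReal (-(f v)) = 0 := ENNReal.ofReal_of_nonpos (by linarith)
    rw [Pi.neg_apply, this, ENNReal.ofReal_eq_zero] at hv
    exact le_antisymm hv h0
  · rw [ENNReal.ofReal_of_nonpos h0, eq_comm, ENNReal.ofReal_eq_zero, Pi.neg_apply] at hv
    exact le_antisymm h0 (neg_nonpos.1 hv)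

/-- An integrable function whose Fourier transform vanishes is zero almost everywhere. -/
theorem ae_eq_zero_of_integral_mul_exp_eq_zero [SigmaFinite μ] (hL' : ∀ v ≠ 0, L v ≠ 0)
    (hL : Continuous fun p : V × W => L p.1 p.2) {f : V → ℂ} (hf : Integrable f μ)
    (h : ∀ w, ∫ v, f v * Complex.exp (L v w * Complex.I) ∂μ = 0) : f =ᵐ[μ] 0 := by
  -- Conjugation turns the transform at -w into that of the conjugate at w, so the real and
  -- imaginary parts can be treated separately.
  have hconj (w : W) : ∫ v, conj (f v) * Complex.exp (L v w * Complex.I) ∂μ = 0 := by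
    rw [← map_zero (starRingEnd ℂ), ← h (-w), ← integral_conj]
    refine integral_congr_ae (Filter.Eventually.of_forall fun v => ?_)
    simp [← Complex.exp_conj]
  have hi := integrable_mul_exp hL hf
  have hi' := integrable_mul_exp hL (f := fun v => conj (f v))
    (Complex.conjCLE.integrable_comp_iff.2 hf)
  have hre := ae_eq_zero_of_integral_ofReal_mul_exp_eq_zero hL' hL hf.re fun w => by
    have : ∫ v, (1 / 2 : ℂ) * (f v * Complex.exp (L v w * Complex.I) +
        conj (f v) * Complex.exp (L v w * Complex.I)) ∂μ = 0 := by
      rw [integral_const_mul, integral_add (hi w) (hi' w), h, hconj]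
      simp
    rw [← this]
    refine integral_congr_ae (Filter.Eventually.of_forall fun v => ?_)
    simp only [RCLike.re_eq_complex_re, Complex.re_eq_add_conj]
    ring
  have him := ae_eq_zero_of_integral_ofReal_mul_exp_eq_zero hL' hL hf.im fun w => by
    have : ∫ v, (1 / (2 * Complex.I) : ℂ) * (f v * Complex.exp (L v w * Complex.I) -
        conj (f v) * Complex.exp (L v w * Complex.I)) ∂μ = 0 := by
      rw [integral_const_mul, integral_sub (hi w) (hi' w), h, hconj]
      simp
    rw [← this]
    refine integral_congr_ae (Filter.Eventually.of_forall fun v => ?_)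
    simp only [RCLike.im_eq_complex_im, Complex.im_eq_sub_conj]
    ring
  filter_upwards [hre, him] with v h1 h2
  exact Complex.ext h1 h2

end FourierUniqueness

/-! ### Uniqueness of the Weyl symbol -/

section SymbolUniqueness

variable {n : ℕ} {ħ : ℝ}

/-- The phase-space translate `x ↦ e^{(i/ħ) p·x} g(x - q)` of a test function. -/
noncomputable def displaced (ħ : ℝ) (g : Conf n → ℂ) (q p : Conf n) (x : Conf n) : ℂ :=
  Complex.exp (Complex.I / (ħ : ℂ) * (inner ℝ p x : ℝ)) * g (x - q)

theorem hasCompactSupport_displaced {g : Conf n → ℂ} (hg : HasCompactSupport g) (q p : Conf n) :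
    HasCompactSupport (displaced ħ g q p) :=
  (hg.comp_homeomorph (Homeomorph.subRight q)).mul_left

theorem contDiff_displaced {g : Conf n → ℂ} (hg : ContDiff ℝ (⊤ : ℕ∞) g) (q p : Conf n) :
    ContDiff ℝ (⊤ : ℕ∞) (displaced ħ g q p) := by
  have h : ContDiff ℝ (⊤ : ℕ∞) fun x : Conf n => ((inner ℝ p x : ℝ) : ℂ) :=
    Complex.ofRealCLM.contDiff.comp (contDiff_const.inner ℝ contDiff_id)
  unfold displaced
  fun_prop

/-- Covariance of the cross-Wigner transform under phase-space translations. -/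
theorem crossWigner_displaced (g : Conf n → ℂ) (q k s t x p : Conf n) :
    crossWigner ħ (displaced ħ g (q + s) (k + t)) (displaced ħ g (q - s) (k - t)) (x, p) =
      Complex.exp (Complex.I / (ħ : ℂ) * (2 * inner ℝ t x - 2 * inner ℝ (p - k) s : ℝ)) *
        crossWigner ħ g g (x - q, p - k) := by
  simp only [crossWigner]
  rw [mul_left_comm]
  congr 1
  -- The shift y ↦ y + 2s absorbs the opposite displacements ±s of the two arguments.
  rw [← integral_const_mul, ← integral_add_right_eq_self _ ((2 : ℝ) • s)]
  congr 1
  funext y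
  have h1 : x + (1 / 2 : ℝ) • (y + (2 : ℝ) • s) - (q + s) = x - q + (1 / 2 : ℝ) • y := by module
  have h2 : x - (1 / 2 : ℝ) • (y + (2 : ℝ) • s) - (q - s) = x - q - (1 / 2 : ℝ) • y := by module
  simp only [displaced, h1, h2, map_mul]
  rw [← Complex.exp_conj]
  have h3 (a b c d e : ℂ) : Complex.exp a * (Complex.exp b * c) * (Complex.exp d * e) =
      Complex.exp (a + b + d) * (c * e) := by
    rw [Complex.exp_add, Complex.exp_add]; ring
  have h4 (a b c d : ℂ) : Complex.exp a * (Complex.exp b * c * d) =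
      Complex.exp (a + b) * (c * d) := by
    rw [Complex.exp_add]; ring
  rw [h3, h4]
  congr 2
  simp only [map_mul, map_div₀, Complex.conj_I, Complex.conj_ofReal, inner_add_left,
    inner_add_right, inner_sub_left, inner_sub_right, inner_smul_right]
  push_cast
  ring

/-- The duality of phase space with itself given by the Euclidean inner product. -/
noncomputable def phasePairing (n : ℕ) :
    (Conf n × Conf n) →ₗ[ℝ] (Conf n × Conf n) →ₗ[ℝ] ℝ :=
  LinearMap.mk₂ ℝ (fun z w => inner ℝ w.1 z.1 + inner ℝ w.2 z.2)
    (fun _ _ _ => by simp [inner_add_right]; ring) (fun _ _ _ => by simp [inner_smul_right]; ring)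
    (fun _ _ _ => by simp [inner_add_left]; ring)
    (fun _ _ _ => by simp [real_inner_smul_left]; ring)

theorem phasePairing_apply (z w : Conf n × Conf n) :
    phasePairing n z w = inner ℝ w.1 z.1 + inner ℝ w.2 z.2 := rfl

theorem phasePairing_ne_zero {z : Conf n × Conf n} (hz : z ≠ 0) : phasePairing n z ≠ 0 := by
  intro h
  have h1 := LinearMap.congr_fun h z
  rw [phasePairing_apply, LinearMap.zero_apply, real_inner_self_eq_norm_sq,
    real_inner_self_eq_norm_sq] at h1
  apply hz
  ext1
  · exact norm_eq_zero.1 (pow_eq_zero_iff two_ne_zero |>.1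
      (by nlinarith [sq_nonneg ‖z.1‖, sq_nonneg ‖z.2‖]))
  · exact norm_eq_zero.1 (pow_eq_zero_iff two_ne_zero |>.1
      (by nlinarith [sq_nonneg ‖z.1‖, sq_nonneg ‖z.2‖]))

theorem continuous_phasePairing :
    Continuous fun p : (Conf n × Conf n) × (Conf n × Conf n) => phasePairing n p.1 p.2 := by
  simp only [phasePairing_apply]
  fun_prop

theorem exists_compactlySupported_schwartz (n : ℕ) :
    ∃ g : 𝓢(Conf n, ℂ), HasCompactSupport g ∧ g ≠ 0 := by
  let f : ContDiffBump (0 : Conf n) := ⟨1, 2, by norm_num, by norm_num⟩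
  have hc : HasCompactSupport fun x => (f x : ℂ) :=
    f.hasCompactSupport.comp_left (g := fun r : ℝ => (r : ℂ)) Complex.ofReal_zero
  refine ⟨hc.toSchwartzMap (Complex.ofRealCLM.contDiff.comp f.contDiff), hc, fun h => ?_⟩
  have h0 := DFunLike.congr_fun h (0 : Conf n)
  have h1 : f (0 : Conf n) = 1 := f.one_of_mem_closedBall (by simp [f.rIn_pos.le])
  change ((f 0 : ℝ) : ℂ) = 0 at h0
  rw [h1] at h0
  simp at h0

/-- Displacing the two copies of g by ζ ± (s, t) multiplies the translated W(g, g) by a plane wave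
of arbitrary frequency. The hypothesis then says that the Fourier transform of this integrable
product vanishes. -/
theorem ae_eq_zero_mul_crossWigner_translate (hħ : 0 < ħ) {c : Conf n × Conf n → ℂ}
    (h : ∀ φ ψ : 𝓢(Conf n, ℂ), Integrable (fun z => c z * crossWigner ħ φ ψ z) ∧
      ∫ z, c z * crossWigner ħ φ ψ z = 0)
    {g : 𝓢(Conf n, ℂ)} (hg : HasCompactSupport g) (ζ : Conf n × Conf n) :
    (fun z => c z * crossWigner ħ g g (z - ζ)) =ᵐ[volume] 0 := by
  obtain ⟨q, k⟩ := ζ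
  have h' (s t : Conf n) := h
    ((hasCompactSupport_displaced (ħ := ħ) hg (q + s) (k + t)).toSchwartzMap
      (contDiff_displaced g.smooth' _ _))
    ((hasCompactSupport_displaced (ħ := ħ) hg (q - s) (k - t)).toSchwartzMap
      (contDiff_displaced g.smooth' _ _))
  have hW (s t : Conf n) (z : Conf n × Conf n) :
      crossWigner ħ ((hasCompactSupport_displaced (ħ := ħ) hg (q + s) (k + t)).toSchwartzMap
        (contDiff_displaced g.smooth' _ _))
      ((hasCompactSupport_displaced (ħ := ħ) hg (q - s) (k - t)).toSchwartzMap
        (contDiff_displaced g.smooth' _ _)) z = _ :=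
    crossWigner_displaced (ħ := ħ) g q k s t z.1 z.2
  simp only [hW] at h'
  refine ae_eq_zero_of_integral_mul_exp_eq_zero (fun z => phasePairing_ne_zero)
    continuous_phasePairing ?_ fun w => ?_
  · have h0 := (h' 0 0).1
    simp only [inner_zero_left, inner_zero_right, mul_zero, sub_zero, Complex.ofReal_zero,
      Complex.exp_zero, one_mul] at h0
    exact h0
  -- These s and t give the phase w.1·x + w.2·(p - k); the constant part w.2·k is the prefactor in
  -- the next display.
  · have h1 := (h' (-(ħ / 2) • w.2) ((ħ / 2) • w.1)).2
    have h2 : ∫ z, Complex.exp (-Complex.I * (inner ℝ w.2 k : ℝ)) *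
        (c z * crossWigner ħ g g (z - (q, k)) *
          Complex.exp (phasePairing n z w * Complex.I)) = 0 := by
      rw [← h1]
      refine integral_congr_ae (Filter.Eventually.of_forall fun z => ?_)
      dsimp only
      have hb (a b d e : ℂ) : Complex.exp a * (d * e * Complex.exp b) =
          d * (Complex.exp (a + b) * e) := by
        rw [Complex.exp_add]; ring
      rw [hb]
      have hħ' : (ħ : ℂ) ≠ 0 := by exact_mod_cast hħ.ne'
      congr 3
      rw [phasePairing_apply]
      simp only [inner_smul_left, inner_smul_right, inner_sub_right, real_inner_comm w.2,
        conj_trivial]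
      push_cast
      field_simp
      ring
    rw [integral_const_mul] at h2
    exact (mul_eq_zero.1 h2).resolve_left (Complex.exp_ne_zero _)

/-- A Weyl symbol is determined by its pairings with cross-Wigner transforms. -/
theorem ae_eq_zero_of_integral_mul_crossWigner (hħ : 0 < ħ) {c : Conf n × Conf n → ℂ}
    (hc : AEStronglyMeasurable c volume)
    (h : ∀ φ ψ : 𝓢(Conf n, ℂ), Integrable (fun z => c z * crossWigner ħ φ ψ z) ∧
      ∫ z, c z * crossWigner ħ φ ψ z = 0) : c =ᵐ[volume] 0 := by
  obtain ⟨g, hg, hg0⟩ := exists_compactlySupported_schwartz n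
  have hw := stronglyMeasurable_crossWigner (ħ := ħ) g g
  -- By Moyal, W(g, g) = 0 almost everywhere would force g = 0.
  have hK : ∫⁻ z, ‖crossWigner ħ g g z‖ₑ ≠ 0 := by
    intro hK
    rw [lintegral_eq_zero_iff hw.enorm] at hK
    have h1 := integral_inner_crossWigner hħ g g g g
    have h2 : ∫ z, conj (crossWigner ħ g g z) * crossWigner ħ g g z = 0 := by
      rw [← integral_zero (Conf n × Conf n) ℂ]
      refine integral_congr_ae ?_
      filter_upwards [hK] with z hz
      rw [enorm_eq_zero.1 hz, mul_zero]
    rw [h2, eq_comm, mul_eq_zero, mul_self_eq_zero, inner_self_eq_zero] at h1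
    have hpi := Real.pi_pos
    rcases h1 with h1 | h1
    · have : (1 / (2 * Real.pi * ħ)) ^ n ≠ 0 := by positivity
      exact this (by exact_mod_cast h1)
    · refine hg0 (SchwartzMap.injective_toLp 2 volume ?_)
      change g.toLp 2 volume = _
      rw [h1]
      exact (map_zero (SchwartzMap.toLpCLM ℂ ℂ 2 volume)).symm
  -- Each translate gives a null set depending on ζ, so c vanishes only where W(g, g) does not.
  -- Integrating over ζ as well and applying Tonelli gives ‖c‖₁‖W(g, g)‖₁ = 0, where either norm may
  -- be infinite.
  have h0 : ∫⁻ z, ∫⁻ ζ, ‖hc.mk c z‖ₑ * ‖crossWigner ħ g g (z + ζ)‖ₑ = 0 := by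
    rw [lintegral_lintegral_swap]
    · rw [lintegral_eq_zero_of_ae_eq_zero]
      refine Filter.Eventually.of_forall fun ζ => ?_
      refine lintegral_eq_zero_of_ae_eq_zero ?_
      filter_upwards [ae_eq_zero_mul_crossWigner_translate hħ h hg (-ζ), hc.ae_eq_mk] with z h1 h2
      rw [sub_neg_eq_add] at h1
      rw [← h2, ← enorm_mul, h1]
      simp
    · have m1 := hc.stronglyMeasurable_mk.measurable.enorm
      have m2 := hw.measurable.enorm
      exact (by fun_prop : Measurable fun p : (Conf n × Conf n) × (Conf n × Conf n) =>
        ‖hc.mk c p.1‖ₑ * ‖crossWigner ħ g g (p.1 + p.2)‖ₑ).aemeasurable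
  have h1 (z : Conf n × Conf n) : ∫⁻ ζ, ‖hc.mk c z‖ₑ * ‖crossWigner ħ g g (z + ζ)‖ₑ =
      ‖hc.mk c z‖ₑ * ∫⁻ ζ, ‖crossWigner ħ g g ζ‖ₑ := by
    have m2 := hw.measurable.enorm
    have : (volume : Measure (Conf n × Conf n)).IsAddHaarMeasure :=
      inferInstanceAs (Measure.IsAddHaarMeasure (Measure.prod volume volume))
    rw [lintegral_const_mul _ (by fun_prop),
      lintegral_add_left_eq_self (fun ζ => ‖crossWigner ħ g g ζ‖ₑ) z]
  simp only [h1] at h0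
  have m1 := hc.stronglyMeasurable_mk.measurable.enorm
  rw [lintegral_mul_const _ m1, mul_eq_zero, or_iff_left hK, lintegral_eq_zero_iff m1] at h0
  filter_upwards [h0, hc.ae_eq_mk] with z h2 h3
  rw [h3]
  exact enorm_eq_zero.1 h2

end SymbolUniqueness

/-! ### The square integrable symbol of a Hilbert–Schmidt operator -/

section Symbol

variable {n : ℕ} {ħ : ℝ} {ι : Type*}

theorem exists_schwartz_hilbertBasis (n : ℕ) :
    ∃ (ι : Type) (e : HilbertBasis ι ℂ (StateSpace n)) (σ : ι → 𝓢(Conf n, ℂ)),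
      ∀ i, e i = (σ i).toLp 2 volume := by
  have : Fact ((2 : ENNReal) ≠ ⊤) := ⟨by simp⟩
  obtain ⟨ι, e, he⟩ := exists_hilbertBasis_mem
    (LinearMap.range (SchwartzMap.toLpCLM ℂ ℂ 2 (volume : Measure (Conf n))).toLinearMap)
    (SchwartzMap.denseRange_toLpCLM (by simp))
  choose σ hσ using he
  exact ⟨ι, e, σ, fun i => (hσ i).symm⟩

/-- Substitute y ↦ -y. -/
theorem conj_crossWigner (φ ψ : Conf n → ℂ) (z : Conf n × Conf n) :
    conj (crossWigner ħ φ ψ z) = crossWigner ħ ψ φ z := by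
  rw [crossWigner, crossWigner, map_mul, Complex.conj_ofReal, ← integral_conj]
  congr 1
  rw [← integral_neg_eq_self]
  refine integral_congr_ae (Filter.Eventually.of_forall fun y => ?_)
  simp only [map_mul, Complex.conj_conj, ← Complex.exp_conj, inner_neg_right, smul_neg,
    sub_neg_eq_add, ← sub_eq_add_neg, map_neg, map_div₀, Complex.conj_I, Complex.conj_ofReal,
    Complex.ofReal_neg]
  rw [mul_right_comm]
  congr 3
  ring

/-- The cross-Wigner transform of Schwartz functions as an element of `L²(ℝ²ⁿ)`. -/
noncomputable def wignerLp (hħ : 0 < ħ) (φ ψ : 𝓢(Conf n, ℂ)) :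
    Lp ℂ 2 (volume : Measure (Conf n × Conf n)) :=
  (memLp_crossWigner hħ φ ψ).toLp

theorem inner_wignerLp_left (hħ : 0 < ħ) (φ ψ : 𝓢(Conf n, ℂ))
    (α : Lp ℂ 2 (volume : Measure (Conf n × Conf n))) :
    inner ℂ (wignerLp hħ ψ φ) α = ∫ z, α z * crossWigner ħ φ ψ z := by
  rw [L2.inner_def]
  refine integral_congr_ae ?_
  filter_upwards [(memLp_crossWigner hħ ψ φ).coeFn_toLp] with z hz
  rw [wignerLp, hz, RCLike.inner_apply, conj_crossWigner]

theorem inner_wignerLp_wignerLp (hħ : 0 < ħ) (φ₁ ψ₁ φ₂ ψ₂ : 𝓢(Conf n, ℂ)) :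
    inner ℂ (wignerLp hħ φ₁ ψ₁) (wignerLp hħ φ₂ ψ₂) = ((1 / (2 * Real.pi * ħ)) ^ n : ℝ) *
      (inner ℂ (φ₁.toLp 2) (φ₂.toLp 2) * inner ℂ (ψ₂.toLp 2) (ψ₁.toLp 2)) := by
  rw [← integral_inner_crossWigner hħ, inner_wignerLp_left]
  refine integral_congr_ae ?_
  filter_upwards [(memLp_crossWigner hħ φ₂ ψ₂).coeFn_toLp] with z hz
  rw [wignerLp, hz, conj_crossWigner, mul_comm]

/-- The normalization `(2πħ)^{-n/2}` that makes cross-Wigner transforms orthonormal. -/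
noncomputable def wignerScale (n : ℕ) (ħ : ℝ) : ℝ := Real.sqrt ((1 / (2 * Real.pi * ħ)) ^ n)

theorem wignerScale_pos (hħ : 0 < ħ) : 0 < wignerScale n ħ := by
  have := Real.pi_pos
  exact Real.sqrt_pos.2 (by positivity)

theorem wignerScale_sq (hħ : 0 < ħ) : wignerScale n ħ ^ 2 = (1 / (2 * Real.pi * ħ)) ^ n := by
  have := Real.pi_pos
  exact Real.sq_sqrt (by positivity)

theorem orthonormal_wignerLp (hħ : 0 < ħ) {e : HilbertBasis ι ℂ (StateSpace n)}
    {σ : ι → 𝓢(Conf n, ℂ)} (he : ∀ i, e i = (σ i).toLp 2 volume) :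
    Orthonormal ℂ fun p : ι × ι =>
      ((wignerScale n ħ)⁻¹ : ℂ) • wignerLp hħ (σ p.2) (σ p.1) := by
  classical
  have hr : (wignerScale n ħ : ℂ) ≠ 0 := by exact_mod_cast (wignerScale_pos hħ).ne'
  have ho := orthonormal_iff_ite.1 e.orthonormal
  rw [orthonormal_iff_ite]
  rintro ⟨j, k⟩ ⟨j', k'⟩
  rw [inner_smul_left, inner_smul_right, inner_wignerLp_wignerLp, ← wignerScale_sq hħ, ← he, ← he,
    ← he, ← he, ho, ho, map_inv₀, Complex.conj_ofReal]
  by_cases hj : j = j' <;> by_cases hk : k = k' <;> simp [hj, hk, Ne.symm, eq_comm]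
  field_simp

/-- The matrix of a Hilbert–Schmidt operator as a square summable family. -/
noncomputable def matrixCoeff {A : StateSpace n →L[ℂ] StateSpace n} (hA : IsHilbertSchmidt A)
    (e : HilbertBasis ι ℂ (StateSpace n)) : lp (fun _ : ι × ι => ℂ) 2 :=
  ⟨fun p => inner ℂ (e p.2) (A (e p.1)), by
    refine memℓp_gen ?_
    simpa using summable_norm_inner_sq e e (hA.summable e)⟩

theorem matrixCoeff_apply {A : StateSpace n →L[ℂ] StateSpace n} (hA : IsHilbertSchmidt A)
    (e : HilbertBasis ι ℂ (StateSpace n)) (p : ι × ι) :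
    matrixCoeff hA e p = inner ℂ (e p.2) (A (e p.1)) := rfl

theorem hasSum_inner_matrixCoeff {A B : StateSpace n →L[ℂ] StateSpace n} (hA : IsHilbertSchmidt A)
    (hB : IsHilbertSchmidt B) (e : HilbertBasis ι ℂ (StateSpace n)) :
    HasSum (fun j => inner ℂ (A (e j)) (B (e j)))
      (inner ℂ (matrixCoeff hA e) (matrixCoeff hB e)) := by
  refine (lp.hasSum_inner (matrixCoeff hA e) (matrixCoeff hB e)).prod_fiberwise fun j => ?_
  refine (e.hasSum_inner_mul_inner (A (e j)) (B (e j))).congr_fun fun k => ?_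
  rw [matrixCoeff_apply, matrixCoeff_apply, RCLike.inner_apply', inner_conj_symm]

/-- The square integrable Weyl symbol of a Hilbert–Schmidt operator. -/
noncomputable def hsSymbol (hħ : 0 < ħ) {A : StateSpace n →L[ℂ] StateSpace n}
    (hA : IsHilbertSchmidt A) {e : HilbertBasis ι ℂ (StateSpace n)} {σ : ι → 𝓢(Conf n, ℂ)}
    (he : ∀ i, e i = (σ i).toLp 2 volume) : Lp ℂ 2 (volume : Measure (Conf n × Conf n)) :=
  ((wignerScale n ħ)⁻¹ : ℂ) •
    (orthonormal_wignerLp hħ he).orthogonalFamily.linearIsometry (matrixCoeff hA e)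

/-- The isometry preserves inner products, so only the outer factor (2πħ)^{n/2} of each symbol
remains. -/
theorem inner_hsSymbol (hħ : 0 < ħ) {A B : StateSpace n →L[ℂ] StateSpace n}
    (hA : IsHilbertSchmidt A) (hB : IsHilbertSchmidt B) {e : HilbertBasis ι ℂ (StateSpace n)}
    {σ : ι → 𝓢(Conf n, ℂ)} (he : ∀ i, e i = (σ i).toLp 2 volume) :
    ((1 / (2 * Real.pi * ħ)) ^ n : ℝ) * inner ℂ (hsSymbol hħ hA he) (hsSymbol hħ hB he) =
      inner ℂ (matrixCoeff hA e) (matrixCoeff hB e) := by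
  have hr : (wignerScale n ħ : ℂ) ≠ 0 := by exact_mod_cast (wignerScale_pos hħ).ne'
  rw [hsSymbol, hsSymbol, inner_smul_left, inner_smul_right, LinearIsometry.inner_map_map,
    ← wignerScale_sq hħ, map_inv₀, Complex.conj_ofReal]
  push_cast
  field_simp

theorem hasSum_hsSymbol (hħ : 0 < ħ) {A : StateSpace n →L[ℂ] StateSpace n}
    (hA : IsHilbertSchmidt A) {e : HilbertBasis ι ℂ (StateSpace n)} {σ : ι → 𝓢(Conf n, ℂ)}
    (he : ∀ i, e i = (σ i).toLp 2 volume) :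
    HasSum (fun p : ι × ι => (((wignerScale n ħ)⁻¹ : ℂ) * inner ℂ (e p.2) (A (e p.1)) *
      (wignerScale n ħ)⁻¹) • wignerLp hħ (σ p.2) (σ p.1)) (hsSymbol hħ hA he) := by
  have h := ((orthonormal_wignerLp hħ he).orthogonalFamily.hasSum_linearIsometry
    (matrixCoeff hA e)).const_smul ((wignerScale n ħ)⁻¹ : ℂ)
  refine h.congr_fun fun p => ?_
  rw [LinearIsometry.toSpanSingleton_apply, smul_smul, smul_smul, matrixCoeff_apply,
    Complex.ofReal_inv]

/-- Pairing the series termwise with W(ψ, φ), Moyal gives ∑ ⟨ψ|e_k⟩⟨e_k|A e_j⟩⟨e_j|φ⟩; Parseval in k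
and then in j sums this to ⟨ψ|Aφ⟩. -/
theorem integral_hsSymbol_mul_crossWigner (hħ : 0 < ħ) {A : StateSpace n →L[ℂ] StateSpace n}
    (hA : IsHilbertSchmidt A) {e : HilbertBasis ι ℂ (StateSpace n)} {σ : ι → 𝓢(Conf n, ℂ)}
    (he : ∀ i, e i = (σ i).toLp 2 volume) (φ ψ : 𝓢(Conf n, ℂ)) :
    ∫ z, hsSymbol hħ hA he z * crossWigner ħ φ ψ z =
      inner ℂ (ψ.toLp 2 volume) (A (φ.toLp 2 volume)) := by
  have hr : (wignerScale n ħ : ℂ) ≠ 0 := by exact_mod_cast (wignerScale_pos hħ).ne'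
  rw [← inner_wignerLp_left hħ]
  have h2 := (innerSL ℂ (wignerLp hħ ψ φ)).hasSum (hasSum_hsSymbol hħ hA he)
  have h3 : HasSum (fun p : ι × ι => inner ℂ (ψ.toLp 2 volume) (e p.2) *
      inner ℂ (e p.2) (A (e p.1)) * inner ℂ (e p.1) (φ.toLp 2 volume))
      (inner ℂ (wignerLp hħ ψ φ) (hsSymbol hħ hA he)) := by
    refine h2.congr_fun fun p => ?_
    rw [innerSL_apply_apply, inner_smul_right, inner_wignerLp_wignerLp, ← he, ← he,
      ← wignerScale_sq hħ]
    push_cast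
    field_simp
  have h4 : HasSum (fun j => inner ℂ (ψ.toLp 2 volume) (A (e j)) *
      inner ℂ (e j) (φ.toLp 2 volume)) (inner ℂ (wignerLp hħ ψ φ) (hsSymbol hħ hA he)) := by
    refine h3.prod_fiberwise fun j => ?_
    exact (e.hasSum_inner_mul_inner (ψ.toLp 2 volume) (A (e j))).mul_right
      (inner ℂ (e j) (φ.toLp 2 volume))
  have h5 := e.hasSum_inner_mul_inner (ContinuousLinearMap.adjoint A (ψ.toLp 2 volume))
    (φ.toLp 2 volume)
  simp only [ContinuousLinearMap.adjoint_inner_left] at h5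
  exact h4.unique h5

/-- The Weyl symbol of a Hilbert–Schmidt operator agrees with its square integrable symbol. -/
theorem IsWeylOperator.ae_eq_hsSymbol (hħ : 0 < ħ) {a : Conf n × Conf n → ℂ}
    {A : StateSpace n →L[ℂ] StateSpace n} (hW : IsWeylOperator ħ a A)
    (hA : IsHilbertSchmidt A) {e : HilbertBasis ι ℂ (StateSpace n)} {σ : ι → 𝓢(Conf n, ℂ)}
    (he : ∀ i, e i = (σ i).toLp 2 volume) : a =ᵐ[volume] hsSymbol hħ hA he := by
  have h := ae_eq_zero_of_integral_mul_crossWigner hħ (c := fun z => a z - hsSymbol hħ hA he z)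
    (hW.1.sub (Lp.aestronglyMeasurable _)) fun φ ψ => by
      have hi : Integrable fun z => hsSymbol hħ hA he z * crossWigner ħ φ ψ z :=
        (Lp.memLp (hsSymbol hħ hA he)).integrable_mul (memLp_crossWigner hħ φ ψ)
      simp only [sub_mul]
      refine ⟨(hW.2 φ ψ).1.sub hi, ?_⟩
      rw [integral_sub (hW.2 φ ψ).1 hi, ← (hW.2 φ ψ).2, integral_hsSymbol_mul_crossWigner, sub_self]
  filter_upwards [h] with z hz
  exact sub_eq_zero.1 hz

theorem IsWeylOperator.memLp (hħ : 0 < ħ) {a : Conf n × Conf n → ℂ}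
    {A : StateSpace n →L[ℂ] StateSpace n} (hW : IsWeylOperator ħ a A)
    (hA : IsHilbertSchmidt A) : MemLp a 2 volume := by
  obtain ⟨ι, e, σ, he⟩ := exists_schwartz_hilbertBasis n
  exact (memLp_congr_ae (hW.ae_eq_hsSymbol hħ hA he)).2 (Lp.memLp _)

/-- The Hilbert–Schmidt inner product in terms of Weyl symbols. -/
theorem IsWeylOperator.hasHSInner (hħ : 0 < ħ) {a b : Conf n × Conf n → ℂ}
    {A B : StateSpace n →L[ℂ] StateSpace n} (hWA : IsWeylOperator ħ a A)
    (hWB : IsWeylOperator ħ b B) (hA : IsHilbertSchmidt A) (hB : IsHilbertSchmidt B) :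
    HasHSInner A B (((1 / (2 * Real.pi * ħ)) ^ n : ℝ) * ∫ z, conj (a z) * b z) := by
  obtain ⟨ι, e, σ, he⟩ := exists_schwartz_hilbertBasis n
  refine hA.hasHSInner hB e ?_
  convert hasSum_inner_matrixCoeff hA hB e using 1
  rw [← inner_hsSymbol hħ hA hB he, L2.inner_def]
  congr 1
  refine integral_congr_ae ?_
  filter_upwards [hWA.ae_eq_hsSymbol hħ hA he, hWB.ae_eq_hsSymbol hħ hB he] with z h1 h2
  rw [h1, h2, RCLike.inner_apply']

theorem IsWeylOperator.adjoint {a : Conf n × Conf n → ℂ} {A : StateSpace n →L[ℂ] StateSpace n}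
    (hW : IsWeylOperator ħ a A) :
    IsWeylOperator ħ (fun z => conj (a z)) (ContinuousLinearMap.adjoint A) := by
  have h (φ ψ : 𝓢(Conf n, ℂ)) (z : Conf n × Conf n) :
      conj (a z) * crossWigner ħ φ ψ z = conj (a z * crossWigner ħ ψ φ z) := by
    rw [map_mul, conj_crossWigner]
  refine ⟨Complex.continuous_conj.comp_aestronglyMeasurable hW.1, fun φ ψ => ?_⟩
  simp only [h]
  refine ⟨Complex.conjCLE.integrable_comp_iff.2 (hW.2 ψ φ).1, ?_⟩
  rw [integral_conj, ← (hW.2 ψ φ).2, inner_conj_symm, ContinuousLinearMap.adjoint_inner_right]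

end Symbol

end WeylTrace

/-! ### The trace formulas -/

theorem mainTheorem6 (n : ℕ) (ħ : ℝ) (hħ : 0 < ħ)
    (a b : WeylTrace.Conf n × WeylTrace.Conf n → ℂ)
    (A B : WeylTrace.StateSpace n →L[ℂ] WeylTrace.StateSpace n)
    (hA : WeylTrace.IsWeylOperator ħ a A) (hB : WeylTrace.IsWeylOperator ħ b B)
    (hA2 : WeylTrace.IsHilbertSchmidt A) (hB2 : WeylTrace.IsHilbertSchmidt B) :
    (MemLp a 2 volume ∧ MemLp b 2 volume) ∧
    (WeylTrace.IsTraceClass (A ∘L B) ∧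
      Integrable (fun z => a z * b z) volume ∧
      WeylTrace.HasTrace (A ∘L B)
        (((1 / (2 * Real.pi * ħ)) ^ n : ℝ) * ∫ z, a z * b z)) ∧
    (Integrable (fun z => conj (a z) * b z) volume ∧
      WeylTrace.IsTraceClass (ContinuousLinearMap.adjoint A ∘L B) ∧
      WeylTrace.HasHSInner A B
        (((1 / (2 * Real.pi * ħ)) ^ n : ℝ) * ∫ z, conj (a z) * b z)) ∧
    (∃ r : ℝ, WeylTrace.HasHSNorm A r ∧
      WeylTrace.HasTrace (ContinuousLinearMap.adjoint A ∘L A) ((r ^ 2 : ℝ) : ℂ) ∧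
      Integrable (fun z => ‖a z‖ ^ 2) volume ∧
      r ^ 2 = (1 / (2 * Real.pi * ħ)) ^ n * ∫ z, ‖a z‖ ^ 2) := by
  have ha := hA.memLp hħ hA2
  have hb := hB.memLp hħ hB2
  have hAA := hA.hasHSInner hħ hA hA2 hA2
  -- Tr(AB) is the Hilbert–Schmidt inner product of A† and B, and A† has symbol a*.
  have hAdj := hA.adjoint.hasHSInner hħ hB hA2.adjoint hB2
  have hTr := hA2.adjoint.isTraceClass_adjoint_comp hB2
  simp only [Complex.conj_conj] at hAdj
  rw [ContinuousLinearMap.adjoint_adjoint] at hTr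
  refine ⟨⟨ha, hb⟩, ⟨hTr, ha.integrable_mul hb, ?_⟩, ⟨ha.star.integrable_mul hb,
    hA2.isTraceClass_adjoint_comp hB2, hA.hasHSInner hħ hB hA2 hB2⟩, ?_⟩
  · simpa only [ContinuousLinearMap.adjoint_adjoint] using hAdj.1
  have hpi := Real.pi_pos
  have hr : Real.sqrt ((1 / (2 * Real.pi * ħ)) ^ n * ∫ z, ‖a z‖ ^ 2) ^ 2 =
      (1 / (2 * Real.pi * ħ)) ^ n * ∫ z, ‖a z‖ ^ 2 :=
    Real.sq_sqrt (mul_nonneg (by positivity) (integral_nonneg fun _ => by positivity))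
  have hs : (((1 / (2 * Real.pi * ħ)) ^ n : ℝ) * ∫ z, conj (a z) * a z : ℂ) =
      (((1 / (2 * Real.pi * ħ)) ^ n * ∫ z, ‖a z‖ ^ 2 : ℝ) : ℂ) := by
    rw [Complex.ofReal_mul, ← integral_complex_ofReal]
    congr 2
    funext z
    rw [← Complex.normSq_eq_conj_mul_self, Complex.normSq_eq_norm_sq]
  rw [hs] at hAA
  refine ⟨Real.sqrt ((1 / (2 * Real.pi * ħ)) ^ n * ∫ z, ‖a z‖ ^ 2),
    ⟨Real.sqrt_nonneg _, fun ι ψ => ?_⟩, ?_, ?_, hr⟩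
  · rw [hr]
    have h := Complex.hasSum_re (hAA.2 ι ψ)
    rw [Complex.ofReal_re] at h
    refine h.congr_fun fun j => ?_
    rw [inner_self_eq_norm_sq_to_K]
    norm_cast
  · rw [hr]
    exact hAA.1
  · exact (memLp_two_iff_integrable_sq_norm ha.1).1 ha
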